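/- **Setting.** Let $\mathcal H_{CP}(\eta,\Gamma,\xi,h)=\mathcal H_0+\alpha^3\mathcal H_{CP,1}$ be the secular coplanar Hamiltonian (symplectic form $d\xi\wedge d\eta+dh\wedge d\Gamma$) of a satellite with semi-major axis $29600$ km, in units in which this axis, the mass parameter of the Earth and $L$ equal $1$. With $M=\xi^2+\eta^2$, $q=2L-M$, $a=q-4\Gamma$, $b=3q+4\Gamma$, $c=4L-M$, $k=(Lq)^{-2}$, $$\mathcal H_0=\frac{\rho_0}{2}\,\frac{q^2-24q\Gamma-48\Gamma^2}{L^3q^5},$$ $$\mathcal H_{CP,1}=\frac{\rho_1}{L^2}\sum_{m=0}^2 f_m\Big[\mathcal D_{m,0}\Big(\tfrac{\xi^2-\eta^2}{2}\cos((1-m)h)+\xi\eta\sin((1-m)h)\Big)+\mathcal D_{m,1}(8L^2+12LM-3M^2)\cos(mh)+\mathcal D_{m,2}\Big(\tfrac{\xi^2-\eta^2}{2}\cos((1+m)h)+\xi\eta\sin((1+m)h)\Big)\Big],$$ $$\mathcal D_{0,0}=\mathcal D_{0,2}=-\tfrac{15}{128}k\,abc,\quad \mathcal D_{0,1}=\tfrac{1}{128}k(q^2-24q\Gamma-48\Gamma^2),\quad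 \mathcal D_{1,0}=\tfrac{15}{64}k\,a^{1/2}b^{3/2}c,\quad \mathcal D_{1,1}=-\tfrac{3}{64}k\sqrt{ab}\,(q+4\Gamma),$$ $$\mathcal D_{1,2}=-\tfrac{15}{64}k\,a^{3/2}b^{1/2}c,\quad \mathcal D_{2,0}=\tfrac{15}{64}k\,b^2c,\quad \mathcal D_{2,1}=\tfrac{3}{64}k\,ab,\quad \mathcal D_{2,2}=\tfrac{15}{64}k\,a^2c,$$ on the region $q,a,b>0$. Here $\alpha=0.077$, $\rho_0=1.08\cdot10^{-3}(6378.14/29600)^2$, $\rho_1=\frac{4902.87}{398600.44}(1-0.0549006^2)^{-3/2}$ and, with $C=\cos(\epsilon/2)$, $S=\sin(\epsilon/2)$, $\epsilon=23.44^\circ$: $f_0=\frac12(1-6C^2+6C^4)$, $f_1=-CS^{-1}(2C^4-3C^2+1)$, $f_2=-\frac12C^2S^{-2}(C^2-1)^2$. Let $n=2\pi/\mathcal T$, where $\mathcal T$ is $6585.321347$ days expressed in the unit of time $\sqrt{(29600\text{ km})^3/(398600.44\text{ km}^3\text{s}^{-2})}$. Let $E_{\min}=-2.12\cdot10^{-7}$,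 $E_{\max}=1.36\cdot10^{-6}$, and $E=-nJ$ for $J\in[J_{\min},J_{\max}]=[-E_{\max}/n,-E_{\min}/n]$. **Hypothesis.** For every $E\in[E_{\min},E_{\max}]$ the Hamiltonian flow of $\mathcal H_{CP}$ has a hyperbolic periodic orbit $\mathcal P_E(t)=(0,\Gamma_E(t),0,h_E(t))$ of energy $E$ and minimal period $T(E)$, with $h_E(0)=0$, $\dot h_E\neq0$ and $\Gamma_E\in[0,0.49\,L]$; $\mathcal P_E$ and $T(E)$ depend smoothly on $E$ and $T$ is strictly increasing. For $J\in[J_{\min},J_{\max}]$ let $\sigma\in\{1,-1\}$ be the sign of $\dot h_E$ and let $\mathcal T_0(J)=\sigma\,T(E)$ be the signed period, i.e. the time in which $h_E$ increases by $2\pi$. Consider in the extended phase space $(\eta,\Gamma,J,\xi,h,\Omega_M)$, with $h$ and $\Omega_M$ angles, the reparametrized flow (defined where $\partial_\Gamma\mathcal H_{CP}\ne0$) $$\frac{d\xi}{ds}=\frac{\partial_\eta\mathcal H_{CP}}{\partial_\Gamma\mathcal H_{CP}},\quad \frac{d\eta}{ds}=-\frac{\partial_\xi\mathcal H_{CP}}{\partial_\Gamma\mathcal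 H_{CP}},\quad \frac{dh}{ds}=1,\quad \frac{d\Gamma}{ds}=-\frac{\partial_h\mathcal H_{CP}}{\partial_\Gamma\mathcal H_{CP}},\quad \frac{d\Omega_M}{ds}=\frac{n}{\partial_\Gamma\mathcal H_{CP}},\quad \frac{dJ}{ds}=0,$$ and in the section $\{h=0\}$ the cylinder $\widetilde\Lambda_0$ of the points $\mathcal G_0(J,\Omega_M)$ with $(\eta,\Gamma,\xi,h)=(0,\Gamma_E(0),0,0)$, $J\in[J_{\min},J_{\max}]$. Let $*\in\{\mathrm{pri},\mathrm{sec}\}$, let $\mathtt D\subseteq[J_{\min},J_{\max}]$ and for $J\in\mathtt D$ let $\chi^*_J(s)$, $s\in\mathbb R$, be a trajectory of the $(\eta,\Gamma,\xi,h)$ components of this flow which tends exponentially to the periodic orbit $\mathcal P_E$ as $s\to\pm\infty$ and whose initial point $\chi^*_J(0)$ lies on $\{\eta=0,h=0,\xi>0\}$ (if $*=\mathrm{pri}$) or on $\{\xi=0,h=0,\eta>0\}$ (if $*=\mathrm{sec}$). Let $\Xi^*$ be the set of the points $\mathcal C^*(J,\Omega_M)$ with $(\eta,\Gamma,\xi,h)=\chi^*_J(0)$,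 $J\in\mathtt D$, $\Omega_M\in\mathbb T$. The scattering map of $\Xi^*$ sends $Q_-\in\widetilde\Lambda_0$ to $Q_+\in\widetilde\Lambda_0$ if there is $Q\in\Xi^*$ whose trajectory is exponentially asymptotic to that of $Q_+$ as $s\to+\infty$ and to that of $Q_-$ as $s\to-\infty$. **Conclusion.** There are functions $\zeta^*,\zeta^*_+,\zeta^*_-$ such that the scattering map is exactly $$\mathcal G_0(J,\Omega_M)\mapsto\mathcal G_0\big(J,\Omega_M+n\,\zeta^*(J)\big),\qquad J\in\mathtt D,\ \Omega_M\in\mathbb T;$$ for $J\in\mathtt D$ the unique point of $\widetilde\Lambda_0$ to which $\mathcal C^*(J,\Omega_M)$ is exponentially asymptotic as $s\to\pm\infty$ is $\mathcal G_0(J,\Omega_M+n\,\zeta^*_\pm(J))$; and, for $J\in\mathtt D$, $\zeta^*(J)=\zeta^*_+(J)-\zeta^*_-(J)$ and $$\zeta^*_+(J)=-\zeta^*_-(J)=\lim_{N\to+\infty}\sum_{l=0}^{N-1}\left(\int_{2\pi l}^{2\pi(l+1)}\frac{ds}{\partial_\Gamma\mathcal H_{CP}(\chi^*_J(s))}-\mathcal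 T_0(J)\right),$$ where the limit exists. -/

import Mathlib

open Real Filter Topology

namespace CoplanarScattering

noncomputable section

/-! ### Physical constants

Unit of length: the semi-major axis `29600 km`; unit of time: such that the orbital period is `2π`.
In these units the mass parameter of the Earth is `1`. -/

/-- Semi-major axis of the satellite, in km (the unit of length). -/
def lengthUnitKm : ℝ := 29600

/-- Mass parameter of the Earth, in km³/s². -/
def muEarth : ℝ := 398600.44

/-- Unit of time in seconds: `√(a³/μ)`. -/
def timeUnitSec : ℝ := √(lengthUnitKm ^ 3 / muEarth)

/-- The Delaunay action `L = √(μ a)`, which is `1` in these units. -/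
def delL : ℝ := 1

/-- Ratio of the semi-major axes of the satellite and of the Moon. -/
def ratioAlpha : ℝ := 0.077

/-- `ρ₀ = μ⁴ J₂ R²`. -/
def rhoZero : ℝ := 1.08e-3 * (6378.14 / lengthUnitKm) ^ 2

/-- Eccentricity of the Moon. -/
def eMoon : ℝ := 0.0549006

/-- `ρ₁ = μ μ_M / (1 - e_M²)^{3/2}`. -/
def rhoOne : ℝ := (4902.87 / muEarth) / ((1 - eMoon ^ 2) * √(1 - eMoon ^ 2))

/-- Obliquity of the ecliptic, `23.44°`. -/
def obliquity : ℝ := 23.44 * (π / 180)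

/-- `n_{Ω_M} = 2π / 𝒯_{Ω_M}`, where `𝒯_{Ω_M} = 6585.321347` days. -/
def nOmega : ℝ := 2 * π / (6585.321347 * 86400 / timeUnitSec)

def energyMin : ℝ := -2.12e-7
def energyMax : ℝ := 1.36e-6

/-! ### The coplanar secular Hamiltonian in Poincaré variables `(η, Γ, ξ, h)` -/

/-- A point `![η, Γ, ξ, h]`; the angle `h` is lifted to `ℝ`. -/
abbrev State := Fin 4 → ℝ

/-- The Giacaglia functions `U₂^{m,0}(ε)`, for `m = 0, 1, 2`. -/
def giacaglia : Fin 3 → ℝ :=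
  let C := cos (obliquity / 2)
  let S := sin (obliquity / 2)
  ![1 - 6 * C ^ 2 + 6 * C ^ 4,
    -3 * C * S⁻¹ * (2 * C ^ 4 - 3 * C ^ 2 + 1),
    6 * C ^ 2 * (S ^ 2)⁻¹ * (C ^ 2 - 1) ^ 2]

/-- `f_m⁰ = ĉ_m U₂^{m,0}` with `ĉ = (1/2, 1/3, -1/12)`. -/
def fZero (m : Fin 3) : ℝ := (![1 / 2, 1 / 3, -1 / 12] : Fin 3 → ℝ) m * giacaglia m

/-- `M = ξ² + η²`. -/
def sqNorm (z : State) : ℝ := z 2 ^ 2 + z 0 ^ 2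

/-- `2L - M` (four times the action `y`, twice the Delaunay action `G`). -/
def qFun (z : State) : ℝ := 2 * delL - sqNorm z

/-- `2L - M - 4Γ`. -/
def aFun (z : State) : ℝ := 2 * delL - sqNorm z - 4 * z 1

/-- `6L - 3M + 4Γ`. -/
def bFun (z : State) : ℝ := 6 * delL - 3 * sqNorm z + 4 * z 1

/-- The coefficients `𝒟_{m,p}(η, Γ, ξ)`. -/
def coeffD (z : State) : Matrix (Fin 3) (Fin 3) ℝ :=
  let k := (delL ^ 2 * qFun z ^ 2)⁻¹
  let c := 4 * delL - sqNorm z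
  let a := aFun z
  let b := bFun z
  let q := qFun z
  let G := z 1
  !![-15 / 128 * k * (a * b * c),
      1 / 128 * k * (q ^ 2 - 24 * q * G - 48 * G ^ 2),
      -15 / 128 * k * (a * b * c);
     15 / 64 * k * (√a * (b * √b) * c),
      -3 / 64 * k * (√(a * b) * (q + 4 * G)),
      -15 / 64 * k * ((a * √a) * √b * c);
     15 / 64 * k * (b ^ 2 * c),
      3 / 64 * k * (a * b),
      15 / 64 * k * (a ^ 2 * c)]

/-- The oblateness term `ℋ₀`. -/
def hamZero (z : State) : ℝ :=
  rhoZero / 2 * ((qFun z ^ 2 - 24 * qFun z * z 1 - 48 * z 1 ^ 2) / (delL ^ 3 * qFun z ^ 5))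

/-- The lunar term `ℋ_{CP,1}` for a coplanar Moon. -/
def hamLunar (z : State) : ℝ :=
  let η := z 0
  let ξ := z 2
  let h := z 3
  let M := sqNorm z
  rhoOne / delL ^ 2 * ∑ m : Fin 3,
    (fZero m * coeffD z m 0 *
        ((ξ ^ 2 - η ^ 2) / 2 * cos ((1 - ((m : ℕ) : ℝ)) * h)
          + ξ * η * sin ((1 - ((m : ℕ) : ℝ)) * h))
      + fZero m * coeffD z m 1 *
        (8 * delL ^ 2 + 12 * delL * M - 3 * M ^ 2) * cos (((m : ℕ) : ℝ) * h)
      + fZero m * coeffD z m 2 *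
        ((ξ ^ 2 - η ^ 2) / 2 * cos ((1 + ((m : ℕ) : ℝ)) * h)
          + ξ * η * sin ((1 + ((m : ℕ) : ℝ)) * h)))

/-- The coplanar Hamiltonian `ℋ_CP = ℋ₀ + α³ ℋ_{CP,1}`. -/
def hamCP (z : State) : ℝ := hamZero z + ratioAlpha ^ 3 * hamLunar z

/-- The open set where the Poincaré variables describe non-degenerate ellipses (`G > 0`,
`|cos i| < 1`); the Hamiltonian is analytic there. -/
def region : Set State := {z | 0 < qFun z ∧ 0 < aFun z ∧ 0 < bFun z}

/-- `i`-th partial derivative of `ℋ_CP` with respect to `(η, Γ, ξ, h)`. -/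
def pd (i : Fin 4) (z : State) : ℝ := fderiv ℝ hamCP z (Pi.single i 1)

/-- The Hamiltonian vector field for the symplectic form `dξ ∧ dη + dh ∧ dΓ`:
`η' = -∂_ξ`, `Γ' = -∂_h`, `ξ' = ∂_η`, `h' = ∂_Γ`. -/
def hamField (z : State) : State := ![-pd 2 z, -pd 3 z, pd 0 z, pd 1 z]

/-! ### The circular periodic orbits -/

/-- The reduced phase space, where `h` is an angle: points `(η, Γ, ξ, h)`. -/
abbrev RedPhase := ℝ × ℝ × ℝ × Real.Angle

/-- Reduction of the angle `h` modulo `2π`. -/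
def red (z : State) : RedPhase := (z 0, z 1, z 2, (z 3 : Real.Angle))

/-- The point `(0, Γ, 0, h)` of the circular plane `{η = ξ = 0}`. -/
def circ (G h : ℝ) : State := ![0, G, 0, h]

/-- Hyperbolicity of a `T`-periodic orbit `P` of the Hamiltonian flow: the monodromy matrix, obtained
by solving the variational equation along `P` up to time `T`, has eigenvalues `1, 1, ν, ν⁻¹` with
`|ν| > 1`. -/
def IsHyperbolic (P : ℝ → State) (T : ℝ) : Prop :=
  ∃ Ψ : ℝ → Matrix (Fin 4) (Fin 4) ℝ,
    Ψ 0 = 1 ∧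
    (∀ t i j, HasDerivAt (fun τ => Ψ τ i j)
      ((LinearMap.toMatrix' (fderiv ℝ hamField (P t)).toLinearMap * Ψ t) i j) t) ∧
    ∃ ν : ℝ, 1 < |ν| ∧ (Ψ T).charpoly =
      (Polynomial.X - Polynomial.C 1) ^ 2 * (Polynomial.X - Polynomial.C ν)
        * (Polynomial.X - Polynomial.C ν⁻¹)

/-- `t ↦ (0, Γ(t), 0, h(t))` is a hyperbolic circular periodic orbit with energy `E` and minimal
period `T`, along which `h` rotates. -/
structure IsCircularOrbit (E : ℝ) (G h : ℝ → ℝ) (T : ℝ) : Prop where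
  start : h 0 = 0
  solution : ∀ t, HasDerivAt (fun τ => circ (G τ) (h τ)) (hamField (circ (G t) (h t))) t
  rotating : ∀ t, deriv h t ≠ 0
  range : ∀ t, G t ∈ Set.Icc 0 (0.49 * delL)
  energy : ∀ t, hamCP (circ (G t) (h t)) = E
  period : IsLeast {τ : ℝ | 0 < τ ∧ red (circ (G τ) (h τ)) = red (circ (G 0) (h 0))} T
  hyperbolic : IsHyperbolic (fun t => circ (G t) (h t)) T

/-- In every energy level `E ∈ [E_min, E_max]` the circular orbit `𝒫_E = (0, Γ_E, 0, h_E)` is a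
hyperbolic periodic orbit; it and its period depend smoothly on `E`, and the period is strictly
increasing in `E`. -/
structure PeriodicOrbitAnsatz (G h : ℝ → ℝ → ℝ) (T : ℝ → ℝ) : Prop where
  orbit : ∀ E ∈ Set.Icc energyMin energyMax, IsCircularOrbit E (G E) (h E) (T E)
  smooth_orbit : ContDiffOn ℝ ((⊤ : ℕ∞) : WithTop ℕ∞)
    (fun p : ℝ × ℝ => (G p.1 p.2, h p.1 p.2)) (Set.Icc energyMin energyMax ×ˢ Set.univ)
  smooth_period : ContDiffOn ℝ ((⊤ : ℕ∞) : WithTop ℕ∞) T (Set.Icc energyMin energyMax)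
  period_strictMono : StrictMonoOn T (Set.Icc energyMin energyMax)

/-- The energy of `ℋ_CP` on the level `𝒦_CP = 0`: `E = -n_{Ω_M} J`. -/
def energyOf (J : ℝ) : ℝ := -(nOmega * J)

/-- `[J_min, J_max] = [-E_max / n_{Ω_M}, -E_min / n_{Ω_M}]`. -/
def actionRange : Set ℝ := Set.Icc (-energyMax / nOmega) (-energyMin / nOmega)

/-- The period of the orbit on the level `J` counted with the sign of `h'`: the time in
which `h` increases by `2π`. -/
def signedPeriod (h : ℝ → ℝ → ℝ) (T : ℝ → ℝ) (J : ℝ) : ℝ :=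
  Real.sign (deriv (h (energyOf J)) 0) * T (energyOf J)

/-! ### The flow reparametrized by `h` -/

/-- The `(η, Γ, ξ, h)` components of the vector field reparametrized so that `dh/ds = 1`. -/
def reparamField (z : State) : State :=
  ![-pd 2 z / pd 1 z, -pd 3 z / pd 1 z, pd 0 z / pd 1 z, 1]

/-- A trajectory `χ` of the reparametrized flow `φ_CP`, defined for all `s`. -/
def IsReparamTrajectory (χ : ℝ → State) : Prop :=
  ∀ s, χ s ∈ region ∧ pd 1 (χ s) ≠ 0 ∧ HasDerivAt χ (reparamField (χ s)) s

/-- Lifted points `((η, Γ, ξ, h), J, Ω_M)` of the extended phase space. -/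
abbrev ExtState := State × ℝ × ℝ

/-- The extended phase space, where `h` and `Ω_M` are angles. -/
abbrev ExtPhase := RedPhase × ℝ × Real.Angle

/-- Reduction of both angles modulo `2π`. -/
def extRed (w : ExtState) : ExtPhase := (red w.1, w.2.1, (w.2.2 : Real.Angle))

/-- The reparametrized vector field on the extended phase space: `dJ/ds = 0` and
`dΩ_M/ds = n_{Ω_M} / ∂_Γ ℋ_CP`. -/
def extReparamField (w : ExtState) : ExtState := (reparamField w.1, 0, nOmega / pd 1 w.1)

/-- A trajectory of the extended reparametrized flow, defined for all `s`. -/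
def IsExtTrajectory (u : ℝ → ExtState) : Prop :=
  ∀ s, (u s).1 ∈ region ∧ pd 1 (u s).1 ≠ 0 ∧ HasDerivAt u (extReparamField (u s)) s

/-- `f` tends to zero exponentially as `s → +∞`. -/
def ExpDecay (f : ℝ → ℝ) : Prop :=
  ∃ C κ : ℝ, 0 < κ ∧ ∀ s, 0 ≤ s → |f s| ≤ C * exp (-(κ * s))

/-- The leaf `W^s(P)`: points whose trajectory approaches that of `P` exponentially as
`s → +∞`. -/
def stableLeaf (P : ExtPhase) : Set ExtPhase :=
  {Q | ∃ u v : ℝ → ExtState, IsExtTrajectory u ∧ IsExtTrajectory v ∧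
    extRed (u 0) = Q ∧ extRed (v 0) = P ∧
    ExpDecay (fun s => dist (extRed (u s)) (extRed (v s)))}

/-- The leaf `W^u(P)`: points whose trajectory approaches that of `P` exponentially as
`s → -∞`. -/
def unstableLeaf (P : ExtPhase) : Set ExtPhase :=
  {Q | ∃ u v : ℝ → ExtState, IsExtTrajectory u ∧ IsExtTrajectory v ∧
    extRed (u 0) = Q ∧ extRed (v 0) = P ∧
    ExpDecay (fun s => dist (extRed (u (-s))) (extRed (v (-s))))}

/-! ### The cylinder, the homoclinic channels and the scattering maps -/

/-- The point of the cylinder on the section `{h = 0}` with coordinates `(J, Ω_M)`: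
`(η, Γ, ξ, h) = (0, Γ_E(0), 0, 0)` with `E = -n_{Ω_M} J`. -/
def cylPoint (G : ℝ → ℝ → ℝ) (J : ℝ) (Ω : Real.Angle) : ExtPhase :=
  (red (circ (G (energyOf J) 0) 0), J, Ω)

/-- The cylinder on the section `{h = 0}`. -/
def cylinder (G : ℝ → ℝ → ℝ) : Set ExtPhase :=
  {P | ∃ J ∈ actionRange, ∃ Ω : Real.Angle, P = cylPoint G J Ω}

/-- The two kinds of symmetric homoclinic orbits. -/
inductive Branch
  | primary
  | secondary

/-- The half-axis `{η = 0, h = 0, ξ > 0}` (primary) or `{ξ = 0, h = 0, η > 0}` (secondary). -/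
def OnAxis : Branch → State → Prop
  | .primary, z => z 0 = 0 ∧ 0 < z 2 ∧ z 3 = 0
  | .secondary, z => z 2 = 0 ∧ 0 < z 0 ∧ z 3 = 0

/-- The periodic orbit `t ↦ (0, Γ(t), 0, h(t))` as a subset of the reduced phase space. -/
def orbitSet (G h : ℝ → ℝ) : Set RedPhase := Set.range fun t => red (circ (G t) (h t))

/-- `χ` is a trajectory of the reparametrized flow which tends exponentially to the periodic
orbit both as `s → +∞` and as `s → -∞`. -/
def IsHomoclinic (G h : ℝ → ℝ) (χ : ℝ → State) : Prop :=
  IsReparamTrajectory χ ∧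
    ExpDecay (fun s => Metric.infDist (red (χ s)) (orbitSet G h)) ∧
    ExpDecay (fun s => Metric.infDist (red (χ (-s))) (orbitSet G h))

/-- `χ_J`, `J ∈ D`, is a family of homoclinic orbits of the given kind, one on each level
`J ∈ D ⊆ [J_min, J_max]`, that start on the corresponding symmetry half-axis at `s = 0`. -/
def IsHomoclinicFamily (b : Branch) (G h : ℝ → ℝ → ℝ) (D : Set ℝ) (χ : ℝ → ℝ → State) : Prop :=
  D ⊆ actionRange ∧
    ∀ J ∈ D, IsHomoclinic (G (energyOf J)) (h (energyOf J)) (χ J) ∧ OnAxis b (χ J 0)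

/-- The point with coordinates `(J, Ω_M)` of the channel. -/
def channelPoint (χ : ℝ → ℝ → State) (J : ℝ) (Ω : Real.Angle) : ExtPhase := (red (χ J 0), J, Ω)

/-- The channel swept by the points `χ_J(0)`, `J ∈ D`, and all `Ω_M`. -/
def channel (D : Set ℝ) (χ : ℝ → ℝ → State) : Set ExtPhase :=
  {Q | ∃ J ∈ D, ∃ Ω : Real.Angle, Q = channelPoint χ J Ω}

/-- The graph of the scattering map of the channel `Ξ`: `Q₋ ↦ Q₊` whenever some `Q ∈ Ξ` lies in
`W^u(Q₋) ∩ W^s(Q₊)`. -/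
def Scatters (Λ Ξ : Set ExtPhase) (Qm Qp : ExtPhase) : Prop :=
  Qm ∈ Λ ∧ Qp ∈ Λ ∧ ∃ Q ∈ Ξ, Q ∈ unstableLeaf Qm ∧ Q ∈ stableLeaf Qp

end

end CoplanarScattering

open CoplanarScattering

namespace CoplanarScattering

noncomputable section

/-! ### Smoothness of the Hamiltonian -/

@[fun_prop]
lemma contDiff_coord {n : WithTop ℕ∞} (i : Fin 4) : ContDiff ℝ n (fun z : State => z i) :=
  contDiff_apply ℝ ℝ i

@[fun_prop]
lemma contDiff_sqNorm {n : WithTop ℕ∞} : ContDiff ℝ n sqNorm := by unfold sqNorm; fun_prop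
@[fun_prop]
lemma contDiff_qFun {n : WithTop ℕ∞} : ContDiff ℝ n qFun := by unfold qFun; fun_prop
@[fun_prop]
lemma contDiff_aFun {n : WithTop ℕ∞} : ContDiff ℝ n aFun := by unfold aFun; fun_prop
@[fun_prop]
lemma contDiff_bFun {n : WithTop ℕ∞} : ContDiff ℝ n bFun := by unfold bFun; fun_prop

lemma contDiffAt_coeffD {n : WithTop ℕ∞} {z : State} (hz : z ∈ region) (i j : Fin 3) :
    ContDiffAt ℝ n (fun z => coeffD z i j) z := by
  obtain ⟨hq, ha, hb⟩ := hz
  have hk : ContDiffAt ℝ n (fun z => (delL ^ 2 * qFun z ^ 2)⁻¹) z := by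
    refine ContDiffAt.inv (by fun_prop) ?_
    simp [delL, hq.ne']
  have hsa : ContDiffAt ℝ n (fun z => √(aFun z)) z := ContDiffAt.sqrt (by fun_prop) ha.ne'
  have hsb : ContDiffAt ℝ n (fun z => √(bFun z)) z := ContDiffAt.sqrt (by fun_prop) hb.ne'
  have hsab : ContDiffAt ℝ n (fun z => √(aFun z * bFun z)) z :=
    ContDiffAt.sqrt (by fun_prop) (mul_pos ha hb).ne'
  fin_cases i <;> fin_cases j <;> simp [coeffD, -mul_inv_rev] <;> fun_prop

lemma contDiffAt_hamZero {n : WithTop ℕ∞} {z : State} (hz : z ∈ region) :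
    ContDiffAt ℝ n hamZero z := by
  unfold hamZero
  refine contDiffAt_const.mul (ContDiffAt.div (by fun_prop) (by fun_prop) ?_)
  simp [delL, hz.1.ne']

lemma contDiffAt_hamLunar {n : WithTop ℕ∞} {z : State} (hz : z ∈ region) :
    ContDiffAt ℝ n hamLunar z := by
  have := @contDiffAt_coeffD n z hz
  unfold hamLunar
  refine contDiffAt_const.mul (ContDiffAt.sum fun m _ => ?_)
  have h0 := this m 0
  have h1 := this m 1
  have h2 := this m 2
  have hc (c : ℝ) : ContDiff ℝ n (fun z : State => cos (c * z 3)) :=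
    (contDiff_const.mul (contDiff_coord 3)).cos
  have hs (c : ℝ) : ContDiff ℝ n (fun z : State => sin (c * z 3)) :=
    (contDiff_const.mul (contDiff_coord 3)).sin
  have hca (c : ℝ) := (hc c).contDiffAt (x := z)
  have hsa (c : ℝ) := (hs c).contDiffAt (x := z)
  have h3 := hca (1 - ((m : ℕ) : ℝ))
  have h4 := hca (1 + ((m : ℕ) : ℝ))
  have h5 := hca ((m : ℕ) : ℝ)
  have h6 := hsa (1 - ((m : ℕ) : ℝ))
  have h7 := hsa (1 + ((m : ℕ) : ℝ))
  fun_prop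

lemma contDiffAt_hamCP {n : WithTop ℕ∞} {z : State} (hz : z ∈ region) :
    ContDiffAt ℝ n hamCP z :=
  (contDiffAt_hamZero hz).add (contDiffAt_const.mul (contDiffAt_hamLunar hz))

lemma contDiffAt_pd {z : State} (hz : z ∈ region) (i : Fin 4) : ContDiffAt ℝ 1 (pd i) z :=
  ((contDiffAt_hamCP (n := 2) hz).fderiv_right (m := 1) (by norm_num)).clm_apply
    contDiffAt_const

lemma contDiffAt_hamField {z : State} (hz : z ∈ region) : ContDiffAt ℝ 1 hamField z := by
  have h := contDiffAt_pd hz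
  refine contDiffAt_pi.2 fun i => ?_
  fin_cases i
  exacts [(h 2).neg, (h 3).neg, h 0, h 1]

lemma contDiffAt_reparamField {z : State} (hz : z ∈ region) (h1 : pd 1 z ≠ 0) :
    ContDiffAt ℝ 1 reparamField z := by
  have h := contDiffAt_pd hz
  refine contDiffAt_pi.2 fun i => ?_
  fin_cases i
  exacts [(h 2).neg.div (h 1) h1, (h 3).neg.div (h 1) h1, (h 0).div (h 1) h1, contDiffAt_const]

/-! ### Symmetries -/

/-- Translation of the angle `h` by `2πk`. -/
def angleShift (k : ℤ) : State := Pi.single 3 (2 * π * k)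

@[simp] lemma angleShift_zero (k : ℤ) : angleShift k 0 = 0 := by simp [angleShift]
@[simp] lemma angleShift_one (k : ℤ) : angleShift k 1 = 0 := by simp [angleShift]
@[simp] lemma angleShift_two (k : ℤ) : angleShift k 2 = 0 := by simp [angleShift]
@[simp] lemma angleShift_three (k : ℤ) : angleShift k 3 = 2 * π * k := by simp [angleShift]

lemma sqNorm_congr {z w : State} (h0 : z 0 ^ 2 = w 0 ^ 2) (h2 : z 2 ^ 2 = w 2 ^ 2) :
    sqNorm z = sqNorm w := by simp [sqNorm, h0, h2]

lemma mem_region_congr {z w : State} (h0 : z 0 ^ 2 = w 0 ^ 2) (h1 : z 1 = w 1)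
    (h2 : z 2 ^ 2 = w 2 ^ 2) : z ∈ region ↔ w ∈ region := by
  simp [region, qFun, aFun, bFun, sqNorm_congr h0 h2, h1]

/-- The Hamiltonian depends on `η, ξ, h` only through `η²`, `ξ²`, `cos (k h)` and `ξ η sin (k h)`. -/
lemma hamCP_congr {z w : State} (h0 : z 0 ^ 2 = w 0 ^ 2) (h1 : z 1 = w 1)
    (h2 : z 2 ^ 2 = w 2 ^ 2) (hc : ∀ k : ℤ, cos (k * z 3) = cos (k * w 3))
    (hs : ∀ k : ℤ, z 2 * z 0 * sin (k * z 3) = w 2 * w 0 * sin (k * w 3)) :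
    hamCP z = hamCP w := by
  have hM := sqNorm_congr h0 h2
  have hD : coeffD z = coeffD w := by simp only [coeffD, qFun, aFun, bFun, hM, h1]
  have hL : hamLunar z = hamLunar w := by
    unfold hamLunar
    simp only [hD, hM, h0, h2]
    congr 1
    refine Finset.sum_congr rfl fun m _ => ?_
    have e1 := hc (1 - (m : ℕ))
    have e2 := hc (m : ℕ)
    have e3 := hc (1 + (m : ℕ))
    have e4 := hs (1 - (m : ℕ))
    have e5 := hs (1 + (m : ℕ))
    push_cast at e1 e2 e3 e4 e5
    rw [e1, e2, e3, e4, e5]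
  have hZ : hamZero z = hamZero w := by simp [hamZero, qFun, hM, h1]
  simp [hamCP, hL, hZ]

lemma hamCP_add_angleShift (k : ℤ) (z : State) : hamCP (z + angleShift k) = hamCP z := by
  have h (j : ℤ) : (j : ℝ) * (z 3 + 2 * π * k) = j * z 3 + ((j * k : ℤ) : ℝ) * (2 * π) := by
    push_cast; ring
  refine hamCP_congr (by simp) (by simp) (by simp) (fun j => ?_) (fun j => ?_)
  · rw [Pi.add_apply, angleShift_three, h, cos_add_int_mul_two_pi]
  · rw [Pi.add_apply, Pi.add_apply, Pi.add_apply, angleShift_three, h, sin_add_int_mul_two_pi]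
    simp

lemma add_angleShift_mem_region (k : ℤ) (z : State) : z + angleShift k ∈ region ↔ z ∈ region :=
  mem_region_congr (by simp) (by simp) (by simp)

lemma pd_add_angleShift (i : Fin 4) (k : ℤ) (z : State) : pd i (z + angleShift k) = pd i z := by
  have h : (fun w => hamCP (w + angleShift k)) = hamCP := funext (hamCP_add_angleShift k)
  rw [pd, ← fderiv_comp_add_right, h, pd]

lemma hamField_add_angleShift (k : ℤ) (z : State) :
    hamField (z + angleShift k) = hamField z := by
  simp only [hamField, pd_add_angleShift]

lemma reparamField_add_angleShift (k : ℤ) (z : State) :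
    reparamField (z + angleShift k) = reparamField z := by
  simp only [reparamField, pd_add_angleShift]

/-- Signs of the reversor fixing the half-axis of the given branch. -/
def reversorSign : Branch → Fin 4 → ℝ
  | .primary => ![-1, 1, 1, -1]
  | .secondary => ![1, 1, -1, -1]

lemma reversorSign_mul_self (b : Branch) (i : Fin 4) :
    reversorSign b i * reversorSign b i = 1 := by
  cases b <;> fin_cases i <;> simp [reversorSign]

/-- The reversor: `(η, h) ↦ (-η, -h)` (primary) or `(ξ, h) ↦ (-ξ, -h)` (secondary). -/
def reversor (b : Branch) (z : State) : State := fun i => reversorSign b i * z i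

/-- The reversor as a continuous linear equivalence. -/
def reversorEquiv (b : Branch) : State ≃L[ℝ] State :=
  ContinuousLinearEquiv.equivOfInverse
    (ContinuousLinearMap.pi fun i => reversorSign b i • ContinuousLinearMap.proj i)
    (ContinuousLinearMap.pi fun i => reversorSign b i • ContinuousLinearMap.proj i)
    (fun z => by ext i; simp [← mul_assoc, reversorSign_mul_self])
    (fun z => by ext i; simp [← mul_assoc, reversorSign_mul_self])

lemma coe_reversorEquiv (b : Branch) : ⇑(reversorEquiv b) = reversor b := by
  ext z i; simp [reversorEquiv, reversor]

lemma hamCP_reversor (b : Branch) (z : State) : hamCP (reversor b z) = hamCP z := by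
  cases b <;>
  exact hamCP_congr (by simp [reversor, reversorSign]) (by simp [reversor, reversorSign])
    (by simp [reversor, reversorSign]) (by simp [reversor, reversorSign])
    (by simp [reversor, reversorSign])

lemma reversor_mem_region (b : Branch) (z : State) : reversor b z ∈ region ↔ z ∈ region := by
  cases b <;>
  exact mem_region_congr (by simp [reversor, reversorSign]) (by simp [reversor, reversorSign])
    (by simp [reversor, reversorSign])

lemma pd_reversor (b : Branch) (i : Fin 4) (z : State) :
    pd i (reversor b z) = reversorSign b i * pd i z := by
  have h : hamCP ∘ reversorEquiv b = hamCP := by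
    ext w; simp [coe_reversorEquiv, hamCP_reversor]
  have h2 := (reversorEquiv b).comp_right_fderiv (f := hamCP) (x := z)
  rw [h, coe_reversorEquiv] at h2
  have h3 : reversorEquiv b (Pi.single i 1) = reversorSign b i • Pi.single i (1 : ℝ) := by
    rw [coe_reversorEquiv]
    ext j
    by_cases hj : j = i
    · subst hj; simp [reversor]
    · simp [reversor, hj]
  have h4 : pd i z = reversorSign b i * pd i (reversor b z) := by
    simp only [pd]
    rw [h2, ContinuousLinearMap.comp_apply]
    erw [h3]
    rw [map_smul, smul_eq_mul]
  rw [h4, ← mul_assoc, reversorSign_mul_self, one_mul]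

lemma pd_one_reversor (b : Branch) (z : State) : pd 1 (reversor b z) = pd 1 z := by
  rw [pd_reversor]; cases b <;> simp [reversorSign]

lemma reparamField_reversor (b : Branch) (z : State) :
    reparamField (reversor b z) = -reversor b (reparamField z) := by
  ext i
  cases b <;> fin_cases i <;>
    simp [reparamField, pd_reversor] <;> simp [reversor, reversorSign, neg_div]

/-! ### Uniqueness of solutions -/

/-- Two global solutions of an autonomous equation that is `C¹` along them coincide if they agree
at one time. -/
lemma solution_unique {E : Type*} [NormedAddCommGroup E] [NormedSpace ℝ E] {F : E → E}
    {f g : ℝ → E} (hF : ∀ t, ContDiffAt ℝ 1 F (f t)) (hf : ∀ t, HasDerivAt f (F (f t)) t)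
    (hg : ∀ t, HasDerivAt g (F (g t)) t) {t₀ : ℝ} (h0 : f t₀ = g t₀) : f = g := by
  have hfc : Continuous f := continuous_iff_continuousAt.2 fun t => (hf t).continuousAt
  have hgc : Continuous g := continuous_iff_continuousAt.2 fun t => (hg t).continuousAt
  have hcl : IsClosed {t | f t = g t} := isClosed_eq hfc hgc
  have hop : IsOpen {t | f t = g t} := by
    rw [isOpen_iff_mem_nhds]
    intro t ht
    obtain ⟨K, s, hs, hK⟩ := (hF t).exists_lipschitzOnWith
    refine ODE_solution_unique_of_eventually (v := fun _ => F) (s := fun _ => s) (K := K)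
      (Eventually.of_forall fun _ => hK) ?_ ?_ ht
    · filter_upwards [hfc.continuousAt.preimage_mem_nhds hs] with x hx using ⟨hf x, hx⟩
    · have hs' : s ∈ 𝓝 (g t) := by rwa [← show f t = g t from ht]
      filter_upwards [hgc.continuousAt.preimage_mem_nhds hs'] with x hx using ⟨hg x, hx⟩
  have : {t | f t = g t} = Set.univ := IsClopen.eq_univ ⟨hcl, hop⟩ ⟨t₀, h0⟩
  ext1 t
  exact (Set.ext_iff.1 this t).2 trivial

lemma IsReparamTrajectory.eq_of_eq {χ ψ : ℝ → State} (hχ : IsReparamTrajectory χ)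
    (hψ : IsReparamTrajectory ψ) {s : ℝ} (h : χ s = ψ s) : χ = ψ :=
  solution_unique (fun t => contDiffAt_reparamField (hχ t).1 (hχ t).2.1) (fun t => (hχ t).2.2)
    (fun t => (hψ t).2.2) h

lemma IsReparamTrajectory.continuous {χ : ℝ → State} (hχ : IsReparamTrajectory χ) :
    Continuous χ := continuous_iff_continuousAt.2 fun t => (hχ t).2.2.continuousAt

lemma IsReparamTrajectory.angle {χ : ℝ → State} (hχ : IsReparamTrajectory χ) (s : ℝ) :
    χ s 3 = χ 0 3 + s := by
  have h (s : ℝ) : HasDerivAt (fun s => χ s 3 - s) 0 s := by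
    have := ((hasDerivAt_pi.1 (hχ s).2.2) 3).sub (hasDerivAt_id s)
    exact this.congr_deriv (by simp [reparamField])
  have := is_const_of_deriv_eq_zero (fun s => (h s).differentiableAt) (fun s => (h s).deriv) s 0
  simp at this
  linarith

lemma IsReparamTrajectory.continuous_inv_pd {χ : ℝ → State} (hχ : IsReparamTrajectory χ) :
    Continuous fun s => 1 / pd 1 (χ s) :=
  continuous_const.div
    (continuous_iff_continuousAt.2 fun s =>
      (contDiffAt_pd (hχ s).1 1).continuousAt.comp hχ.continuous.continuousAt)
    fun s => (hχ s).2.1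

lemma IsReparamTrajectory.comp_add_const {χ : ℝ → State} (hχ : IsReparamTrajectory χ) (c : ℝ) :
    IsReparamTrajectory fun s => χ (s + c) :=
  fun s => ⟨(hχ _).1, (hχ _).2.1, (hχ (s + c)).2.2.comp_add_const s c⟩

lemma IsReparamTrajectory.add_angleShift {χ : ℝ → State} (hχ : IsReparamTrajectory χ) (k : ℤ) :
    IsReparamTrajectory fun s => χ s + angleShift k := fun s =>
  ⟨(add_angleShift_mem_region k _).2 (hχ s).1, by rw [pd_add_angleShift]; exact (hχ s).2.1, by
    rw [reparamField_add_angleShift]; exact (hχ s).2.2.add_const _⟩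

lemma IsReparamTrajectory.reverse {χ : ℝ → State} (hχ : IsReparamTrajectory χ) (b : Branch) :
    IsReparamTrajectory fun s => reversor b (χ (-s)) := fun s =>
  ⟨(reversor_mem_region b _).2 (hχ _).1, by rw [pd_one_reversor]; exact (hχ _).2.1, by
    rw [reparamField_reversor]
    have h1 : HasDerivAt (fun s => χ (-s)) (-reparamField (χ (-s))) s := by
      exact ((hχ (-s)).2.2.scomp s (hasDerivAt_neg s)).congr_deriv (by simp)
    have h2 := (reversorEquiv b).hasFDerivAt.comp_hasDerivAt s h1
    erw [map_neg, ContinuousLinearEquiv.coe_coe] at h2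
    simpa [coe_reversorEquiv, Function.comp_def] using h2⟩

/-- `∂_Γ ℋ_CP` is even along a trajectory that starts on the fixed set of a reversor. -/
lemma IsReparamTrajectory.pd_one_neg {χ : ℝ → State} (hχ : IsReparamTrajectory χ) {b : Branch}
    (h : reversor b (χ 0) = χ 0) (s : ℝ) : pd 1 (χ (-s)) = pd 1 (χ s) := by
  have := (hχ.reverse b).eq_of_eq hχ (s := 0) (by simpa using h)
  rw [← congrFun this s, pd_one_reversor]

/-! ### The circular orbit parametrized by the angle -/

@[simp] lemma circ_zero (G h : ℝ) : circ G h 0 = 0 := rfl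
@[simp] lemma circ_one (G h : ℝ) : circ G h 1 = G := rfl
@[simp] lemma circ_two (G h : ℝ) : circ G h 2 = 0 := rfl
@[simp] lemma circ_three (G h : ℝ) : circ G h 3 = h := rfl

lemma circ_add_angleShift (G h : ℝ) (k : ℤ) :
    circ G h + angleShift k = circ G (h + 2 * π * k) := by
  ext i; fin_cases i <;> simp

lemma circ_mem_region {G : ℝ} (h : ℝ) (hG : G ∈ Set.Icc 0 (0.49 * delL)) :
    circ G h ∈ region := by
  have h1 := hG.1
  have h2 := hG.2
  norm_num [delL] at h2
  refine ⟨?_, ?_, ?_⟩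
  · norm_num [qFun, sqNorm, delL]
  · norm_num [aFun, sqNorm, delL]; linarith
  · norm_num [bFun, sqNorm, delL]; linarith

lemma hasDerivAt_circ {G h : ℝ → ℝ} {G' h' t : ℝ} (hG : HasDerivAt G G' t)
    (hh : HasDerivAt h h' t) : HasDerivAt (fun t => circ (G t) (h t)) ![0, G', 0, h'] t := by
  rw [hasDerivAt_pi]
  intro i
  fin_cases i
  exacts [hasDerivAt_const _ _, hG, hasDerivAt_const _ _, hh]

lemma IsReparamTrajectory.periodic_of_eq_nat_mul {γ : ℝ → ℝ}
    (hγ : IsReparamTrajectory fun s => circ (γ s) s) {n : ℕ} (hn : 0 < n)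
    (hp : γ (2 * π * n) = γ 0) : Function.Periodic γ (2 * π) := by
  have hc : Continuous γ := (continuous_apply 1).comp hγ.continuous
  have hshift : IsReparamTrajectory fun s => circ (γ (s + 2 * π)) s := by
    have := (hγ.comp_add_const (2 * π)).add_angleShift (-1)
    simp only [circ_add_angleShift] at this
    simpa using this
  by_contra hne
  have hd (s : ℝ) : γ (s + 2 * π) - γ s ≠ 0 := fun h0 => hne fun s' => by
    have := hshift.eq_of_eq hγ (s := s) (congrArg (circ · s) (sub_eq_zero.1 h0))
    exact congrFun (congrFun this s') 1
  have hcd : Continuous fun s => γ (s + 2 * π) - γ s := by fun_prop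
  have hstep (j : ℕ) : 2 * π * ((j + 1 : ℕ) : ℝ) = 2 * π * j + 2 * π := by push_cast; ring
  by_cases hpos : ∃ s, 0 < γ (s + 2 * π) - γ s
  · have hall (s : ℝ) : 0 < γ (s + 2 * π) - γ s := by
      by_contra! hs
      obtain ⟨r, hr⟩ := mem_range_of_exists_le_of_exists_ge hcd ⟨s, hs⟩
        (hpos.imp fun _ h => h.le)
      exact hd r hr
    have hm : StrictMono fun j : ℕ => γ (2 * π * j) := strictMono_nat_of_lt_succ fun j => by
      simp only [hstep]; exact sub_pos.1 (hall _)
    have := hm hn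
    simp only [Nat.cast_zero, mul_zero] at this
    linarith
  · push Not at hpos
    have hm : StrictAnti fun j : ℕ => γ (2 * π * j) := strictAnti_nat_of_succ_lt fun j => by
      simp only [hstep]; exact sub_neg.1 (lt_of_le_of_ne (hpos _) (hd _))
    have := hm hn
    simp only [Nat.cast_zero, mul_zero] at this
    linarith

namespace IsCircularOrbit

variable {E : ℝ} {G h : ℝ → ℝ} {T : ℝ}

lemma mem_region (hO : IsCircularOrbit E G h T) (t : ℝ) : circ (G t) (h t) ∈ region :=
  circ_mem_region _ (hO.range t)

lemma hasDerivAt_angle (hO : IsCircularOrbit E G h T) (t : ℝ) :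
    HasDerivAt h (pd 1 (circ (G t) (h t))) t :=
  hasDerivAt_pi.1 (hO.solution t) 3

lemma hasDerivAt_action (hO : IsCircularOrbit E G h T) (t : ℝ) :
    HasDerivAt G (-pd 3 (circ (G t) (h t))) t :=
  hasDerivAt_pi.1 (hO.solution t) 1

lemma pd_zero_eq_zero (hO : IsCircularOrbit E G h T) (t : ℝ) :
    pd 0 (circ (G t) (h t)) = 0 :=
  (hasDerivAt_pi.1 (hO.solution t) 2).unique (hasDerivAt_const t (0 : ℝ))

lemma pd_two_eq_zero (hO : IsCircularOrbit E G h T) (t : ℝ) :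
    pd 2 (circ (G t) (h t)) = 0 :=
  neg_eq_zero.1 ((hasDerivAt_pi.1 (hO.solution t) 0).unique (hasDerivAt_const t (0 : ℝ)))

lemma pd_one_ne_zero (hO : IsCircularOrbit E G h T) (t : ℝ) :
    pd 1 (circ (G t) (h t)) ≠ 0 :=
  (hO.hasDerivAt_angle t).deriv ▸ hO.rotating t

lemma continuous_pd_one (hO : IsCircularOrbit E G h T) :
    Continuous fun t => pd 1 (circ (G t) (h t)) :=
  continuous_iff_continuousAt.2 fun t =>
    (contDiffAt_pd (hO.mem_region t) 1).continuousAt.comp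
      (f := fun t => circ (G t) (h t)) (hO.solution t).continuousAt

/-- The angle rotates in a constant direction. -/
lemma exists_sign (hO : IsCircularOrbit E G h T) :
    ∃ σ : ℝ, (σ = 1 ∨ σ = -1) ∧ Real.sign (deriv h 0) = σ ∧
      ∀ t, 0 < σ * pd 1 (circ (G t) (h t)) := by
  have key (s t : ℝ) (hs : pd 1 (circ (G s) (h s)) ≤ 0) : pd 1 (circ (G t) (h t)) ≤ 0 := by
    by_contra! ht
    obtain ⟨r, hr⟩ := mem_range_of_exists_le_of_exists_ge hO.continuous_pd_one ⟨s, hs⟩ ⟨t, ht.le⟩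
    exact hO.pd_one_ne_zero r hr
  rw [(hO.hasDerivAt_angle 0).deriv]
  rcases lt_or_gt_of_ne (hO.pd_one_ne_zero 0) with h0 | h0
  · refine ⟨-1, .inr rfl, Real.sign_of_neg h0, fun t => ?_⟩
    have := lt_of_le_of_ne (key 0 t h0.le) (hO.pd_one_ne_zero t)
    linarith
  · refine ⟨1, .inl rfl, Real.sign_of_pos h0, fun t => ?_⟩
    rw [one_mul]
    by_contra! ht
    exact absurd (key t 0 ht) (not_le.2 h0)

lemma period_pos (hO : IsCircularOrbit E G h T) : 0 < T := hO.period.1.1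

/-- After one period the lifted angle has advanced by a multiple of `2π`. -/
lemma exists_winding (hO : IsCircularOrbit E G h T) :
    ∃ k : ℤ, ∀ t, G (t + T) = G t ∧ h (t + T) = h t + 2 * π * k := by
  have hT := hO.period.1.2
  simp only [red, circ_one, circ_three, Prod.mk.injEq] at hT
  obtain ⟨k, hk⟩ := Real.Angle.angle_eq_iff_two_pi_dvd_sub.1 hT.2.2.2
  have := solution_unique (F := hamField) (f := fun t => circ (G (t + T)) (h (t + T)))
    (g := fun t => circ (G t) (h t) + angleShift k) (t₀ := 0)
    (fun t => contDiffAt_hamField (hO.mem_region _))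
    (fun t => (hO.solution (t + T)).comp_add_const t T)
    (fun t => by rw [hamField_add_angleShift]; exact (hO.solution t).add_const _)
    (by
      rw [circ_add_angleShift]
      simp only [zero_add]
      rw [hT.2.1, show h T = h 0 + 2 * π * k by linarith])
  refine ⟨k, fun t => ?_⟩
  have ht := congrFun this t
  simp only [circ_add_angleShift] at ht
  exact ⟨congrFun ht 1, congrFun ht 3⟩

/-- The circular orbit as a graph `Γ = γ(h)`, and the time in which it makes a turn. -/
lemma exists_graph (hO : IsCircularOrbit E G h T) :
    ∃ γ : ℝ → ℝ, (IsReparamTrajectory fun s => circ (γ s) s) ∧ γ 0 = G 0 ∧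
      Function.Periodic γ (2 * π) ∧ (∀ t, G t = γ (h t)) ∧
      ∀ s, ∫ r in s..s + 2 * π, 1 / pd 1 (circ (γ r) r) = Real.sign (deriv h 0) * T := by
  obtain ⟨σ, hσ, hsign, hpos⟩ := hO.exists_sign
  obtain ⟨k, hk⟩ := hO.exists_winding
  have hσσ : σ * σ = 1 := by rcases hσ with rfl | rfl <;> norm_num
  have hhc : Continuous h := continuous_iff_continuousAt.2 fun t =>
    (hO.hasDerivAt_angle t).continuousAt
  have hmono : StrictMono fun t => σ * h t := strictMono_of_hasDerivAt_pos
    (fun t => (hO.hasDerivAt_angle t).const_mul σ) hpos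
  -- surjectivity of the lifted angle
  have hinj : Function.Injective h := fun x y hxy => hmono.injective (by simp only [hxy])
  have hk0 : k ≠ 0 := by
    rintro rfl
    have := (hk 0).2
    simp only [zero_add, Int.cast_zero, mul_zero, add_zero] at this
    exact hO.period_pos.ne' (hinj this)
  have hhT : h T = 2 * π * k := by simpa [hO.start] using (hk 0).2
  have hσk : 0 < σ * k := by
    have := hmono hO.period_pos
    simp only [hO.start, mul_zero, hhT] at this
    have h2 : 0 < 2 * π * (σ * k) := by linarith
    exact pos_of_mul_pos_right h2 (by positivity)
  have hnT (n : ℕ) : h (n * T) = 2 * π * k * n := by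
    induction n with
    | zero => simp [hO.start]
    | succ n ih =>
      push_cast
      rw [add_mul, one_mul, (hk _).2, ih]; ring
  have hnT' (n : ℕ) : h (-(n * T)) = -(2 * π * k * n) := by
    induction n with
    | zero => simp [hO.start]
    | succ n ih =>
      have := (hk (-(((n + 1 : ℕ) : ℝ) * T))).2
      rw [show -(((n + 1 : ℕ) : ℝ) * T) + T = -(n * T) by push_cast; ring, ih] at this
      push_cast at this ⊢
      linarith
  have hsurj : Function.Surjective fun t => σ * h t := by
    intro y
    have hc : Continuous fun t => σ * h t := continuous_const.mul hhc
    have hpk : 0 < 2 * π * (σ * k) := by positivity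
    obtain ⟨n, hn⟩ := exists_nat_ge (|y| / (2 * π * (σ * k)))
    have hy : |y| ≤ n * (2 * π * (σ * k)) := (div_le_iff₀ hpk).1 hn
    refine mem_range_of_exists_le_of_exists_ge hc ⟨-(n * T), ?_⟩ ⟨n * T, ?_⟩
    · rw [hnT']; nlinarith [neg_abs_le y]
    · rw [hnT]; nlinarith [le_abs_self y]
  let e : ℝ ≃o ℝ := hmono.orderIsoOfSurjective _ hsurj
  have he (t : ℝ) : e t = σ * h t := rfl
  let θ : ℝ → ℝ := fun s => e.symm (σ * s)
  have hθc : Continuous θ := e.symm.continuous.comp (continuous_const.mul continuous_id)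
  have hhθ (s : ℝ) : h (θ s) = s := by
    have : σ * h (θ s) = σ * s := by rw [← he]; exact e.apply_symm_apply _
    calc h (θ s) = σ * (σ * h (θ s)) := by rw [← mul_assoc, hσσ, one_mul]
      _ = s := by rw [this, ← mul_assoc, hσσ, one_mul]
  have hθh (t : ℝ) : θ (h t) = t := hinj (hhθ _)
  have hθ' (s : ℝ) : HasDerivAt θ (pd 1 (circ (G (θ s)) s))⁻¹ s := by
    have h1 := hO.hasDerivAt_angle (θ s)
    have h2 := hO.pd_one_ne_zero (θ s)
    rw [hhθ] at h1 h2
    exact h1.of_local_left_inverse hθc.continuousAt h2 (Eventually.of_forall hhθ)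
  have htraj : IsReparamTrajectory fun s => circ (G (θ s)) s := by
    intro s
    have h1 := hO.mem_region (θ s)
    have h2 := hO.pd_one_ne_zero (θ s)
    have h3 := hO.pd_zero_eq_zero (θ s)
    have h4 := hO.pd_two_eq_zero (θ s)
    have h5 := hO.hasDerivAt_action (θ s)
    rw [hhθ] at h1 h2 h3 h4 h5
    refine ⟨h1, h2, ?_⟩
    refine (hasDerivAt_circ (h5.comp s (hθ' s)) (hasDerivAt_id s)).congr_deriv ?_
    simp [reparamField, h3, h4, div_eq_mul_inv]
  have hθk (s : ℝ) : θ (s + 2 * π * k) = θ s + T := hinj (by rw [hhθ, (hk _).2, hhθ])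
  have hθ0 : θ 0 = 0 := by simpa [hO.start] using hθh 0
  have hγk (s : ℝ) : G (θ (s + 2 * π * k)) = G (θ s) := by rw [hθk, (hk _).1]
  have hper : Function.Periodic (fun s => G (θ s)) (2 * π) := by
    refine htraj.periodic_of_eq_nat_mul (Int.natAbs_pos.2 hk0) ?_
    rcases Int.natAbs_eq k with hkk | hkk
    · have := hγk 0
      rw [hkk] at this
      simpa using this
    · have := hγk (-(2 * π * k))
      rw [hkk] at this
      simpa using this.symm
  -- minimality of the period
  have hθσ : θ (2 * π * σ) = T := by
    have hσ2 : (fun s => G (θ s)) (2 * π * σ) = (fun s => G (θ s)) 0 := by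
      rcases hσ with rfl | rfl
      · simpa using hper 0
      · simpa using (hper (-(2 * π))).symm
    have hpos' : 0 < θ (2 * π * σ) := by
      rw [← hθ0]
      refine e.symm.strictMono ?_
      nlinarith [pi_pos]
    have hle : T ≤ θ (2 * π * σ) := by
      refine hO.period.2 ⟨hpos', ?_⟩
      simp only [hθ0] at hσ2
      simp only [red, circ_zero, circ_one, circ_two, circ_three, hσ2, hhθ, hO.start,
        Prod.mk.injEq, true_and]
      refine Real.Angle.angle_eq_iff_two_pi_dvd_sub.2 ?_
      rcases hσ with rfl | rfl
      · exact ⟨1, by simp⟩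
      · exact ⟨-1, by simp⟩
    refine le_antisymm ?_ hle
    rw [← hθh T, hhT]
    refine e.symm.monotone ?_
    have hσk1 : 1 ≤ σ * k := by
      rcases hσ with rfl | rfl
      · rw [one_mul] at hσk ⊢; exact_mod_cast hσk
      · have h1 : (0 : ℝ) < ((-k : ℤ) : ℝ) := by push_cast; linarith
        have h2 : (1 : ℝ) ≤ ((-k : ℤ) : ℝ) := by
          exact_mod_cast Int.add_one_le_iff.2 (Int.cast_pos.1 h1)
        push_cast at h2; linarith
    nlinarith [pi_pos]
  refine ⟨fun s => G (θ s), htraj, by simp only [hθ0], hper, fun t => by simp only [hθh], ?_⟩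
  have hint (a b : ℝ) : ∫ r in a..b, 1 / pd 1 (circ (G (θ r)) r) = θ b - θ a :=
    intervalIntegral.integral_eq_sub_of_hasDerivAt
      (fun s _ => by rw [one_div]; exact hθ' s)
      (htraj.continuous_inv_pd.intervalIntegrable _ _)
  have hpd (s : ℝ) : 1 / pd 1 (circ (G (θ (s + 2 * π))) (s + 2 * π)) =
      1 / pd 1 (circ (G (θ s)) s) := by
    have h1 := circ_add_angleShift (G (θ s)) s 1
    simp only [Int.cast_one, mul_one] at h1
    rw [show G (θ (s + 2 * π)) = G (θ s) from hper s, ← h1, pd_add_angleShift]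
  have hpf : Function.Periodic (fun s => 1 / pd 1 (circ (G (θ s)) s)) (2 * π) := hpd
  intro s
  rw [hsign]
  rcases hσ with rfl | rfl
  · rw [hpf.intervalIntegral_add_eq s 0, hint, zero_add, hθ0]
    rw [mul_one] at hθσ
    rw [hθσ]; ring
  · rw [hpf.intervalIntegral_add_eq s (2 * π * -1), hint, hθσ,
      show 2 * π * -1 + 2 * π = 0 by ring, hθ0]
    ring

end IsCircularOrbit

/-! ### Exponential decay -/

namespace ExpDecay

variable {f g : ℝ → ℝ}

lemma of_le (hf : ExpDecay f) {K : ℝ} (hK : 0 ≤ K) (h : ∀ s, 0 ≤ s → |g s| ≤ K * |f s|) :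
    ExpDecay g := by
  obtain ⟨C, κ, hκ, hC⟩ := hf
  refine ⟨K * C, κ, hκ, fun s hs => (h s hs).trans ?_⟩
  rw [mul_assoc]
  exact mul_le_mul_of_nonneg_left (hC s hs) hK

lemma add (hf : ExpDecay f) (hg : ExpDecay g) : ExpDecay fun s => |f s| + |g s| := by
  obtain ⟨C, κ, hκ, hC⟩ := hf
  obtain ⟨C', κ', hκ', hC'⟩ := hg
  refine ⟨|C| + |C'|, min κ κ', lt_min hκ hκ', fun s hs => ?_⟩
  have h1 : exp (-(κ * s)) ≤ exp (-(min κ κ' * s)) :=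
    exp_le_exp.2 (neg_le_neg (mul_le_mul_of_nonneg_right (min_le_left _ _) hs))
  have h2 : exp (-(κ' * s)) ≤ exp (-(min κ κ' * s)) :=
    exp_le_exp.2 (neg_le_neg (mul_le_mul_of_nonneg_right (min_le_right _ _) hs))
  rw [abs_of_nonneg (by positivity), add_mul]
  refine add_le_add ((hC s hs).trans ?_) ((hC' s hs).trans ?_)
  · exact mul_le_mul (le_abs_self C) h1 (exp_pos _).le (abs_nonneg C)
  · exact mul_le_mul (le_abs_self C') h2 (exp_pos _).le (abs_nonneg C')

lemma tendsto (hf : ExpDecay f) : Tendsto f atTop (𝓝 0) := by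
  obtain ⟨C, κ, hκ, hC⟩ := hf
  have h1 : Tendsto (fun s => C * exp (-(κ * s))) atTop (𝓝 0) := by
    have := (tendsto_exp_neg_atTop_nhds_zero.comp (tendsto_id.const_mul_atTop hκ)).const_mul C
    simpa using this
  refine squeeze_zero_norm' ?_ h1
  filter_upwards [eventually_ge_atTop 0] with s hs using hC s hs

/-- The primitive of an exponentially decaying function converges exponentially. -/
lemma exists_integral_limit (hf : ExpDecay f) (hc : Continuous f) :
    ∃ ζ : ℝ, ExpDecay fun s => (∫ r in (0 : ℝ)..s, f r) - ζ := by
  obtain ⟨C, κ, hκ, hC⟩ := hf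
  have hexp (a : ℝ) : MeasureTheory.IntegrableOn (fun r => C * exp (-(κ * r))) (Set.Ioi a) := by
    simpa [neg_mul, MeasureTheory.IntegrableOn] using (integrableOn_exp_mul_Ioi (neg_neg_of_pos hκ) a).const_mul C
  have hle (a : ℝ) (ha : 0 ≤ a) : ∀ᵐ r ∂MeasureTheory.volume.restrict (Set.Ioi a),
      ‖f r‖ ≤ C * exp (-(κ * r)) := by
    filter_upwards [MeasureTheory.ae_restrict_mem measurableSet_Ioi] with r hr
      using hC r (ha.trans (le_of_lt hr))
  have hint (a : ℝ) (ha : 0 ≤ a) : MeasureTheory.IntegrableOn f (Set.Ioi a) :=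
    (hexp a).mono' hc.aestronglyMeasurable.restrict (hle a ha)
  refine ⟨∫ r in Set.Ioi 0, f r, C / κ, κ, hκ, fun s hs => ?_⟩
  have hsplit := intervalIntegral.integral_interval_add_Ioi (hint 0 le_rfl) (hint s hs)
  have hval : ∫ r in Set.Ioi s, C * exp (-(κ * r)) = C / κ * exp (-(κ * s)) := by
    have := integral_exp_mul_Ioi (neg_neg_of_pos hκ) s
    simp only [neg_mul] at this
    rw [MeasureTheory.integral_const_mul, this]
    field_simp
  beta_reduce
  rw [← hval, ← hsplit, sub_add_cancel_left, abs_neg]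
  exact MeasureTheory.norm_integral_le_of_norm_le (hexp s) (hle s hs)

end ExpDecay

/-! ### Distances between angles -/

lemma angle_dist_eq (a b : ℝ) :
    ∃ k : ℤ, dist (a : Real.Angle) (b : Real.Angle) = |a - b - 2 * π * k| := by
  refine ⟨round ((2 * π)⁻¹ * (a - b)), ?_⟩
  rw [dist_eq_norm, ← Real.Angle.coe_sub, mul_comm (2 * π) (round _ : ℝ)]
  exact AddCircle.norm_eq (2 * π)

lemma angle_dist_le (a b : ℝ) : dist (a : Real.Angle) (b : Real.Angle) ≤ |a - b| := by
  rw [dist_eq_norm, ← Real.Angle.coe_sub]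
  exact QuotientAddGroup.norm_mk_le_norm

lemma dist_red_le (z w : State) : dist (red z) (red w) ≤ dist z w := by
  have h (i : Fin 4) := dist_le_pi_dist z w i
  simp only [red, Prod.dist_eq, sup_le_iff]
  refine ⟨h 0, h 1, h 2, (angle_dist_le _ _).trans (h 3)⟩

/-! ### Convergence towards a periodic graph -/

section Graph

variable {γ : ℝ → ℝ}

lemma circ_add_turns (hp : Function.Periodic γ (2 * π)) (s : ℝ) (k : ℤ) :
    circ (γ (s + 2 * π * k)) (s + 2 * π * k) = circ (γ s) s + angleShift k := by
  rw [circ_add_angleShift, mul_comm (2 * π) (k : ℝ), hp.int_mul k s]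

lemma IsReparamTrajectory.exists_lipschitz_graph
    (hγ : IsReparamTrajectory fun s => circ (γ s) s) (hp : Function.Periodic γ (2 * π)) :
    ∃ K, 0 ≤ K ∧ ∀ a b, |γ a - γ b| ≤ K * |a - b| := by
  have hd (s : ℝ) : HasDerivAt γ (reparamField (circ (γ s) s) 1) s :=
    hasDerivAt_pi.1 (hγ s).2.2 1
  have hc : Continuous fun s => reparamField (circ (γ s) s) 1 :=
    (continuous_apply 1).comp (continuous_iff_continuousAt.2 fun s =>
      (contDiffAt_reparamField (hγ s).1 (hγ s).2.1).continuousAt.comp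
        (f := fun s => circ (γ s) s) hγ.continuous.continuousAt)
  have hper : Function.Periodic (fun s => reparamField (circ (γ s) s) 1) (2 * π) := fun s => by
    have := circ_add_turns hp s 1
    simp only [Int.cast_one, mul_one] at this
    simp only [this, reparamField_add_angleShift]
  obtain ⟨K, hK⟩ := (hper.compact_of_continuous two_pi_pos.ne' hc).isBounded.exists_norm_le
  have hK' (s : ℝ) : ‖reparamField (circ (γ s) s) 1‖ ≤ K := hK _ ⟨s, rfl⟩
  refine ⟨K, (norm_nonneg _).trans (hK' 0), fun a b => ?_⟩
  exact convex_univ.norm_image_sub_le_of_norm_hasDerivWithin_le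
    (fun s _ => (hd s).hasDerivWithinAt) (fun s _ => hK' s) (Set.mem_univ b) (Set.mem_univ a)

/-- The distance to the point of the orbit with the same angle is controlled by the distance to
the orbit. -/
lemma IsReparamTrajectory.exists_dist_le_infDist
    (hγ : IsReparamTrajectory fun s => circ (γ s) s) (hp : Function.Periodic γ (2 * π))
    {G h : ℝ → ℝ} (hG : ∀ t, G t = γ (h t)) :
    ∃ K, 0 ≤ K ∧ ∀ z : State,
      dist z (circ (γ (z 3)) (z 3)) ≤ K * Metric.infDist (red z) (orbitSet G h) := by
  obtain ⟨K, hK, hlip⟩ := hγ.exists_lipschitz_graph hp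
  refine ⟨1 + K, by positivity, fun z => ?_⟩
  rw [← div_le_iff₀' (by positivity)]
  refine le_of_forall_gt_imp_ge_of_dense fun d hd => ?_
  obtain ⟨_, ⟨t, rfl⟩, ht⟩ := (Metric.infDist_lt_iff (Set.range_nonempty _)).1 hd
  simp only [red, Prod.dist_eq, sup_lt_iff, circ_zero, circ_one, circ_two, circ_three, hG] at ht
  obtain ⟨h0, h1, h2, h3⟩ := ht
  obtain ⟨k, hk⟩ := angle_dist_eq (z 3) (h t)
  rw [hk, sub_sub] at h3
  have hd0 : 0 ≤ d := (abs_nonneg _).trans h3.le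
  have hkd : 0 ≤ K * d := mul_nonneg hK hd0
  have hper : γ (h t + 2 * π * k) = γ (h t) := by
    rw [mul_comm (2 * π) (k : ℝ), hp.int_mul k]
  have hγz : |γ (h t) - γ (z 3)| ≤ K * d := by
    rw [abs_sub_comm, ← hper]
    exact (hlip _ _).trans (mul_le_mul_of_nonneg_left h3.le hK)
  rw [div_le_iff₀' (by positivity)]
  refine (dist_pi_le_iff (by positivity)).2 fun i => ?_
  fin_cases i
  · simp at h0 ⊢; nlinarith
  · have := abs_sub_le (z 1) (γ (h t)) (γ (z 3))
    rw [Real.dist_eq] at h1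
    simp [Real.dist_eq]; nlinarith
  · simp at h2 ⊢; nlinarith
  · simp; positivity

/-- `1 / ∂_Γ ℋ_CP` is uniformly Lipschitz near a periodic trajectory. -/
lemma IsReparamTrajectory.exists_lipschitz_inv_pd
    (hγ : IsReparamTrajectory fun s => circ (γ s) s) (hp : Function.Periodic γ (2 * π)) :
    ∃ δ > 0, ∃ K, 0 ≤ K ∧ ∀ s z, dist z (circ (γ s) s) < δ →
      |1 / pd 1 z - 1 / pd 1 (circ (γ s) s)| ≤ K * dist z (circ (γ s) s) := by
  have hloc : ∃ δ > 0, ∃ K, 0 ≤ K ∧ ∀ s ∈ Set.Icc 0 (2 * π), ∀ z, dist z (circ (γ s) s) < δ →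
      |1 / pd 1 z - 1 / pd 1 (circ (γ s) s)| ≤ K * dist z (circ (γ s) s) := by
    refine isCompact_Icc.induction_on
      (p := fun A => ∃ δ > 0, ∃ K, 0 ≤ K ∧ ∀ s ∈ A, ∀ z, dist z (circ (γ s) s) < δ →
        |1 / pd 1 z - 1 / pd 1 (circ (γ s) s)| ≤ K * dist z (circ (γ s) s)) ?_ ?_ ?_ ?_
    · exact ⟨1, one_pos, 0, le_rfl, by simp⟩
    · rintro A B hAB ⟨δ, hδ, K, hK, h⟩
      exact ⟨δ, hδ, K, hK, fun s hs => h s (hAB hs)⟩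
    · rintro A B ⟨δ, hδ, K, hK, h⟩ ⟨δ', hδ', K', hK', h'⟩
      refine ⟨min δ δ', lt_min hδ hδ', max K K', le_max_of_le_left hK, ?_⟩
      rintro s (hs | hs) z hz
      · exact (h s hs z (hz.trans_le (min_le_left _ _))).trans
          (mul_le_mul_of_nonneg_right (le_max_left _ _) dist_nonneg)
      · exact (h' s hs z (hz.trans_le (min_le_right _ _))).trans
          (mul_le_mul_of_nonneg_right (le_max_right _ _) dist_nonneg)
    · intro s _
      have hcd : ContDiffAt ℝ 1 (fun z => 1 / pd 1 z) (circ (γ s) s) :=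
        contDiffAt_const.div (contDiffAt_pd (hγ s).1 1) (hγ s).2.1
      obtain ⟨K, U, hU, hK⟩ := hcd.exists_lipschitzOnWith
      obtain ⟨ε, hε, hball⟩ := Metric.mem_nhds_iff.1 hU
      have hnear := hγ.continuous.continuousAt (x := s) (Metric.ball_mem_nhds _ (half_pos hε))
      refine ⟨_, mem_nhdsWithin_of_mem_nhds hnear, ε / 2, half_pos hε, K, K.2, ?_⟩
      intro r hr z hz
      have hr' : dist (circ (γ r) r) (circ (γ s) s) < ε / 2 := hr
      have := hK.dist_le_mul z (hball ?_) (circ (γ r) r) (hball ?_)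
      · exact this
      · have := dist_triangle z (circ (γ r) r) (circ (γ s) s)
        rw [Metric.mem_ball]; linarith
      · rw [Metric.mem_ball]; linarith
  obtain ⟨δ, hδ, K, hK, h⟩ := hloc
  refine ⟨δ, hδ, K, hK, fun s z hz => ?_⟩
  obtain ⟨r, hr, k, hk⟩ : ∃ r ∈ Set.Icc 0 (2 * π), ∃ k : ℤ, s = r + 2 * π * k := by
    refine ⟨toIcoMod two_pi_pos 0 s, ?_, toIcoDiv two_pi_pos 0 s, ?_⟩
    · have := toIcoMod_mem_Ico two_pi_pos 0 s
      rw [zero_add] at this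
      exact Set.Ico_subset_Icc_self this
    · have := toIcoMod_add_toIcoDiv_zsmul two_pi_pos 0 s
      rw [zsmul_eq_mul] at this
      linarith
  subst hk
  rw [circ_add_turns hp] at hz ⊢
  have hzz : z = z - angleShift k + angleShift k := by simp
  rw [hzz, dist_add_right, pd_add_angleShift, pd_add_angleShift]
  rw [hzz, dist_add_right] at hz
  exact h r hr _ hz

/-- The rate `1 / ∂_Γ ℋ_CP` along an asymptotic trajectory tends exponentially to the rate along
the periodic one. -/
lemma IsReparamTrajectory.expDecay_inv_pd_sub
    (hγ : IsReparamTrajectory fun s => circ (γ s) s) (hp : Function.Periodic γ (2 * π))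
    {χ : ℝ → State} (hχ : IsReparamTrajectory χ)
    (hd : ExpDecay fun s => dist (χ s) (circ (γ s) s)) :
    ExpDecay fun s => 1 / pd 1 (χ s) - 1 / pd 1 (circ (γ s) s) := by
  obtain ⟨δ, hδ, K, hK, hlip⟩ := hγ.exists_lipschitz_inv_pd hp
  obtain ⟨s₀, hs₀⟩ := eventually_atTop.1 (hd.tendsto.eventually (gt_mem_nhds hδ))
  have hc := (hχ.continuous_inv_pd.sub hγ.continuous_inv_pd)
  obtain ⟨B, hB⟩ := (isCompact_Icc (a := 0) (b := s₀)).exists_bound_of_continuousOn hc.continuousOn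
  obtain ⟨C, κ, hκ, hC⟩ := hd
  refine ⟨K * C + |B| * exp (κ * s₀), κ, hκ, fun s hs => ?_⟩
  have hCs := (abs_nonneg _).trans (hC s hs)
  rw [add_mul, mul_assoc, mul_assoc]
  rcases le_total s₀ s with h | h
  · have h1 := hlip s _ (hs₀ s h)
    have h2 := hC s hs
    rw [abs_of_nonneg dist_nonneg] at h2
    have h3 := mul_le_mul_of_nonneg_left h2 hK
    have h4 : 0 ≤ |B| * (exp (κ * s₀) * exp (-(κ * s))) := by positivity
    linarith
  · have h1 := (hB s ⟨hs, h⟩).trans (le_abs_self B)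
    have h2 : 1 ≤ exp (κ * s₀) * exp (-(κ * s)) := by
      rw [← exp_add]
      exact one_le_exp (by nlinarith)
    have h3 := mul_le_mul_of_nonneg_left h2 (abs_nonneg B)
    have h4 := mul_nonneg hK hCs
    simp only [Pi.sub_apply, Real.norm_eq_abs] at h1
    linarith

end Graph

/-! ### Trajectories in the extended phase space -/

lemma hasDerivAt_inv_pd_integral {χ : ℝ → State} (hχ : IsReparamTrajectory χ) (s : ℝ) :
    HasDerivAt (fun s => ∫ r in (0 : ℝ)..s, 1 / pd 1 (χ r)) (1 / pd 1 (χ s)) s :=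
  intervalIntegral.integral_hasDerivAt_right (hχ.continuous_inv_pd.intervalIntegrable _ _)
    (hχ.continuous_inv_pd.stronglyMeasurableAtFilter _ _) hχ.continuous_inv_pd.continuousAt

lemma IsReparamTrajectory.isExtTrajectory {χ : ℝ → State} (hχ : IsReparamTrajectory χ)
    (J ω : ℝ) :
    IsExtTrajectory fun s => (χ s, J, ω + nOmega * ∫ r in (0 : ℝ)..s, 1 / pd 1 (χ r)) := by
  refine fun s => ⟨(hχ s).1, (hχ s).2.1, (hχ s).2.2.prodMk ((hasDerivAt_const s J).prodMk ?_)⟩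
  refine (((hasDerivAt_inv_pd_integral hχ s).const_mul nOmega).const_add ω).congr_deriv ?_
  simp [div_eq_mul_inv]

lemma IsExtTrajectory.action_eq {u : ℝ → ExtState} (hu : IsExtTrajectory u) (s : ℝ) :
    (u s).2.1 = (u 0).2.1 := by
  have hd (s : ℝ) : HasDerivAt (fun s => (u s).2.1) 0 s := (hu s).2.2.snd.fst
  exact is_const_of_deriv_eq_zero (fun s => (hd s).differentiableAt) (fun s => (hd s).deriv) s 0

/-- The phase `Ω_M` of an extended trajectory over `χ`. -/
lemma IsExtTrajectory.phase_eq {u : ℝ → ExtState} (hu : IsExtTrajectory u)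
    {χ : ℝ → State} (hχ : IsReparamTrajectory χ) (h0 : red (u 0).1 = red (χ 0)) (s : ℝ) :
    (u s).2.2 = (u 0).2.2 + nOmega * ∫ r in (0 : ℝ)..s, 1 / pd 1 (χ r) := by
  simp only [red, Prod.mk.injEq] at h0
  obtain ⟨k, hk⟩ := Real.Angle.angle_eq_iff_two_pi_dvd_sub.1 h0.2.2.2
  have hu1 : IsReparamTrajectory fun s => (u s).1 :=
    fun s => ⟨(hu s).1, (hu s).2.1, (hu s).2.2.fst⟩
  have heq := hu1.eq_of_eq (hχ.add_angleShift k) (s := 0) (by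
    ext i
    fin_cases i
    · simpa using h0.1
    · simpa using h0.2.1
    · simpa using h0.2.2.1
    · simp; linarith)
  have hd (s : ℝ) : HasDerivAt
      (fun s => (u s).2.2 - nOmega * ∫ r in (0 : ℝ)..s, 1 / pd 1 (χ r)) 0 s := by
    have h1 : HasDerivAt (fun s => (u s).2.2) (nOmega / pd 1 (u s).1) s := (hu s).2.2.snd.snd
    refine (h1.sub ((hasDerivAt_inv_pd_integral hχ s).const_mul nOmega)).congr_deriv ?_
    rw [show (u s).1 = χ s + angleShift k from congrFun heq s, pd_add_angleShift]
    simp [div_eq_mul_inv]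
  have := is_const_of_deriv_eq_zero (fun s => (hd s).differentiableAt) (fun s => (hd s).deriv) s 0
  simp only [intervalIntegral.integral_same, mul_zero, sub_zero] at this
  linarith

/-! ### Asymptotic phases -/

section Leaf

variable {u v : ℝ → ExtState} {e : ℝ → ℝ}

lemma action_eq_of_asymptotic (hu : IsExtTrajectory u) (hv : IsExtTrajectory v)
    (h : ExpDecay fun s => dist (extRed (u (e s))) (extRed (v (e s)))) :
    (u 0).2.1 = (v 0).2.1 := by
  have hle (s : ℝ) :
      dist (u 0).2.1 (v 0).2.1 ≤ dist (extRed (u (e s))) (extRed (v (e s))) := by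
    rw [← hu.action_eq (e s), ← hv.action_eq (e s)]
    exact (le_max_left _ _).trans (le_max_right _ _)
  exact dist_le_zero.1 (ge_of_tendsto' h.tendsto hle)

/-- Asymptotic trajectories over `χ` and `ψ` exist exactly when the difference of the phases `Ω_M`
is the limit of the difference of the elapsed times. The map `e` is the identity (stable leaves) or
`s ↦ -s` (unstable leaves). -/
lemma exists_asymptotic_iff {χ ψ : ℝ → State} (hχ : IsReparamTrajectory χ)
    (hψ : IsReparamTrajectory ψ) {ζ : ℝ}
    (hd : ExpDecay fun s => dist (χ (e s)) (ψ (e s)))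
    (hζ : ExpDecay fun s => ((∫ r in (0 : ℝ)..e s, 1 / pd 1 (χ r)) -
      ∫ r in (0 : ℝ)..e s, 1 / pd 1 (ψ r)) - ζ)
    (J : ℝ) (Ω Ω' : Real.Angle) :
    (∃ u v : ℝ → ExtState, IsExtTrajectory u ∧ IsExtTrajectory v ∧
      extRed (u 0) = (red (χ 0), J, Ω) ∧ extRed (v 0) = (red (ψ 0), J, Ω') ∧
      ExpDecay (fun s => dist (extRed (u (e s))) (extRed (v (e s))))) ↔
    Ω' = Ω + ((nOmega * ζ : ℝ) : Real.Angle) := by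
  constructor
  · rintro ⟨u, v, hu, hv, hu0, hv0, huv⟩
    simp only [extRed, Prod.mk.injEq] at hu0 hv0
    obtain ⟨hu1, -, rfl⟩ := hu0
    obtain ⟨hv1, -, rfl⟩ := hv0
    have h1 : Tendsto (fun s => dist ((u (e s)).2.2 : Real.Angle) ((v (e s)).2.2 : Real.Angle))
        atTop (𝓝 0) := squeeze_zero (fun _ => dist_nonneg)
      (fun s => (le_max_right _ _).trans (le_max_right _ _)) huv.tendsto
    have h2 : Tendsto (fun s => dist ((u (e s)).2.2 : Real.Angle) ((v (e s)).2.2 : Real.Angle))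
        atTop (𝓝 ‖(((u 0).2.2 - (v 0).2.2 + nOmega * ζ : ℝ) : Real.Angle)‖) := by
      have h3 := (hζ.tendsto.add_const ζ).const_mul nOmega
      simp only [sub_add_cancel, zero_add] at h3
      refine (((Real.Angle.continuous_coe.tendsto _).comp
        (h3.const_add ((u 0).2.2 - (v 0).2.2))).norm).congr fun s => ?_
      rw [hu.phase_eq hχ hu1 (e s), hv.phase_eq hψ hv1 (e s), dist_eq_norm, ← Real.Angle.coe_sub]
      simp only [Function.comp_apply]
      congr 2
      ring
    have h3 := norm_eq_zero.1 (tendsto_nhds_unique h2 h1)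
    rw [Real.Angle.coe_add, Real.Angle.coe_sub, sub_add_eq_add_sub, sub_eq_zero] at h3
    exact h3.symm
  · rintro rfl
    induction Ω using Real.Angle.induction_on with | _ ω
    refine ⟨_, _, hχ.isExtTrajectory J ω, hψ.isExtTrajectory J (ω + nOmega * ζ),
      by simp [extRed], by simp [extRed], ?_⟩
    refine (hd.add hζ).of_le (K := 1 + |nOmega|) (by positivity) fun s _ => ?_
    rw [abs_of_nonneg (dist_nonneg (x := extRed _)), abs_of_nonneg (a := _ + _) (by positivity),
      abs_of_nonneg (dist_nonneg (x := χ (e s)))]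
    generalize hA : (∫ r in (0 : ℝ)..e s, 1 / pd 1 (χ r)) = A
    generalize hB : (∫ r in (0 : ℝ)..e s, 1 / pd 1 (ψ r)) = B
    have h1 := dist_red_le (χ (e s)) (ψ (e s))
    have h2 : dist ((ω + nOmega * A : ℝ) : Real.Angle)
        ((ω + nOmega * ζ + nOmega * B : ℝ) : Real.Angle) ≤ |nOmega| * |A - B - ζ| := by
      refine (angle_dist_le _ _).trans_eq ?_
      rw [← abs_mul]
      congr 1
      ring
    have h3 : 0 ≤ dist (χ (e s)) (ψ (e s)) := dist_nonneg
    have h4 : 0 ≤ |nOmega| * dist (χ (e s)) (ψ (e s)) := by positivity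
    have h5 := abs_nonneg (A - B - ζ)
    have h6 : 0 ≤ |nOmega| * |A - B - ζ| := by positivity
    simp only [extRed, Prod.dist_eq (α := RedPhase), Prod.dist_eq (α := ℝ) (β := Real.Angle),
      dist_self, sup_le_iff]
    exact ⟨by linarith, by positivity, by linarith⟩

end Leaf

lemma nOmega_pos : 0 < nOmega := by
  have : 0 < timeUnitSec := by
    unfold timeUnitSec lengthUnitKm muEarth
    positivity
  unfold nOmega
  positivity

lemma energyOf_mem {J : ℝ} (hJ : J ∈ actionRange) :
    energyOf J ∈ Set.Icc energyMin energyMax := by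
  obtain ⟨h1, h2⟩ := hJ
  rw [div_le_iff₀ nOmega_pos] at h1
  rw [le_div_iff₀ nOmega_pos] at h2
  constructor <;> simp only [energyOf] <;> linarith

/-- Points of a half-axis are fixed by the corresponding reversor. -/
lemma OnAxis.reversor_eq {b : Branch} {z : State} (h : OnAxis b z) : reversor b z = z := by
  ext i
  cases b <;> obtain ⟨h0, -, h3⟩ := h <;> fin_cases i <;> simp [reversor, reversorSign, h0, h3]

lemma reversor_circ_zero (b : Branch) (G : ℝ) : reversor b (circ G 0) = circ G 0 := by
  ext i
  cases b <;> fin_cases i <;> simp [reversor, reversorSign]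

lemma OnAxis.angle_eq {b : Branch} {z : State} (h : OnAxis b z) : z 3 = 0 := by
  cases b <;> exact h.2.2

lemma integral_neg_of_even {f : ℝ → ℝ} (hf : ∀ s, f (-s) = f s) (s : ℝ) :
    ∫ r in (0 : ℝ)..-s, f r = -∫ r in (0 : ℝ)..s, f r := by
  have := intervalIntegral.integral_comp_neg (a := 0) (b := s) f
  simp only [hf, neg_zero] at this
  rw [this, intervalIntegral.integral_symm]

/-- The asymptotic phases of a homoclinic orbit. -/
lemma exists_asymptotic_phase {G h : ℝ → ℝ → ℝ} {T : ℝ → ℝ} (hA : PeriodicOrbitAnsatz G h T)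
    {b : Branch} {D : Set ℝ} {χ : ℝ → ℝ → State} (hχ : IsHomoclinicFamily b G h D χ)
    {J : ℝ} (hJ : J ∈ D) :
    ∃ ζ : ℝ,
      (∀ Ω : Real.Angle, ∀ P ∈ cylinder G,
        (channelPoint χ J Ω ∈ stableLeaf P ↔
          P = cylPoint G J (Ω + ((nOmega * ζ : ℝ) : Real.Angle))) ∧
        (channelPoint χ J Ω ∈ unstableLeaf P ↔
          P = cylPoint G J (Ω + ((nOmega * -ζ : ℝ) : Real.Angle)))) ∧
      Tendsto (fun N : ℕ => ∑ l ∈ Finset.range N,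
        ((∫ s in (2 * π * (l : ℝ))..(2 * π * ((l : ℝ) + 1)), 1 / pd 1 (χ J s))
          - signedPeriod h T J)) atTop (𝓝 ζ) := by
  have hO := hA.orbit _ (energyOf_mem (hχ.1 hJ))
  obtain ⟨⟨htraj, hfwd, hbwd⟩, haxis⟩ := hχ.2 J hJ
  obtain ⟨γ, hγ, hγ0, hper, hG, hturn⟩ := hO.exists_graph
  obtain ⟨K, hK, hdist⟩ := hγ.exists_dist_le_infDist hper hG
  have hangle (s : ℝ) : χ J s 3 = s := by
    rw [htraj.angle, haxis.angle_eq, zero_add]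
  have hdist' (s : ℝ) : |dist (χ J s) (circ (γ s) s)| ≤
      K * |Metric.infDist (red (χ J s)) (orbitSet (G (energyOf J)) (h (energyOf J)))| := by
    have := hdist (χ J s)
    rwa [hangle, ← abs_of_nonneg (dist_nonneg (x := χ J s)),
      ← abs_of_nonneg (Metric.infDist_nonneg (x := red (χ J s)))] at this
  have hdf : ExpDecay fun s => dist (χ J s) (circ (γ s) s) :=
    hfwd.of_le hK fun s _ => hdist' s
  have hdb : ExpDecay fun s => dist (χ J (-s)) (circ (γ (-s)) (-s)) :=
    hbwd.of_le hK fun s _ => hdist' (-s)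
  have hcχ := htraj.continuous_inv_pd
  have hcγ := hγ.continuous_inv_pd
  obtain ⟨ζ, hζ⟩ := (hγ.expDecay_inv_pd_sub hper htraj hdf).exists_integral_limit
    (hcχ.sub hcγ)
  have hsub (s : ℝ) : ∫ r in (0 : ℝ)..s, (1 / pd 1 (χ J r) - 1 / pd 1 (circ (γ r) r)) =
      (∫ r in (0 : ℝ)..s, 1 / pd 1 (χ J r)) - ∫ r in (0 : ℝ)..s, 1 / pd 1 (circ (γ r) r) :=
    intervalIntegral.integral_sub (hcχ.intervalIntegrable _ _) (hcγ.intervalIntegrable _ _)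
  have hζf : ExpDecay fun s => ((∫ r in (0 : ℝ)..s, 1 / pd 1 (χ J r)) -
      ∫ r in (0 : ℝ)..s, 1 / pd 1 (circ (γ r) r)) - ζ := by
    simpa only [hsub] using hζ
  have hζb : ExpDecay fun s => ((∫ r in (0 : ℝ)..-s, 1 / pd 1 (χ J r)) -
      ∫ r in (0 : ℝ)..-s, 1 / pd 1 (circ (γ r) r)) - -ζ := by
    refine hζf.of_le zero_le_one fun s _ => le_of_eq ?_
    rw [integral_neg_of_even fun s => by rw [htraj.pd_one_neg haxis.reversor_eq],
      integral_neg_of_even fun s => by rw [hγ.pd_one_neg (reversor_circ_zero b _)], one_mul,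
      ← abs_neg]
    congr 1
    ring
  have hleaf {e : ℝ → ℝ} {z : ℝ} (hd : ExpDecay fun s => dist (χ J (e s)) (circ (γ (e s)) (e s)))
      (hz : ExpDecay fun s => ((∫ r in (0 : ℝ)..e s, 1 / pd 1 (χ J r)) -
        ∫ r in (0 : ℝ)..e s, 1 / pd 1 (circ (γ r) r)) - z)
      (Ω : Real.Angle) (P : ExtPhase) (hP : P ∈ cylinder G) :
      (∃ u v : ℝ → ExtState, IsExtTrajectory u ∧ IsExtTrajectory v ∧
        extRed (u 0) = channelPoint χ J Ω ∧ extRed (v 0) = P ∧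
        ExpDecay (fun s => dist (extRed (u (e s))) (extRed (v (e s))))) ↔
      P = cylPoint G J (Ω + ((nOmega * z : ℝ) : Real.Angle)) := by
    obtain ⟨J', -, Ω', rfl⟩ := hP
    have hiff := exists_asymptotic_iff htraj hγ hd hz J Ω Ω'
    simp only [hγ0] at hiff
    constructor
    · rintro ⟨u, v, hu, hv, hu0, hv0, huv⟩
      have hJJ := action_eq_of_asymptotic hu hv huv
      rw [show (u 0).2.1 = J from congrArg (fun w : ExtPhase => w.2.1) hu0,
        show (v 0).2.1 = J' from congrArg (fun w : ExtPhase => w.2.1) hv0] at hJJ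
      subst hJJ
      rw [hiff.1 ⟨u, v, hu, hv, hu0, hv0, huv⟩]
    · intro hP
      obtain rfl : J' = J := congrArg (fun w : ExtPhase => w.2.1) hP
      exact hiff.2 (congrArg (fun w : ExtPhase => w.2.2) hP)
  refine ⟨ζ, fun Ω P hP => ⟨hleaf hdf hζf Ω P hP, hleaf hdb hζb Ω P hP⟩, ?_⟩
  have hlim : Tendsto (fun s => (∫ r in (0 : ℝ)..s, 1 / pd 1 (χ J r)) -
      ∫ r in (0 : ℝ)..s, 1 / pd 1 (circ (γ r) r)) atTop (𝓝 ζ) := by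
    simpa using hζf.tendsto.add_const ζ
  have hN : Tendsto (fun N : ℕ => 2 * π * (N : ℝ)) atTop atTop :=
    tendsto_natCast_atTop_atTop.const_mul_atTop two_pi_pos
  refine (hlim.comp hN).congr fun N => ?_
  have hper (l : ℕ) : signedPeriod h T J =
      ∫ r in (2 * π * (l : ℝ))..(2 * π * ((l : ℝ) + 1)), 1 / pd 1 (circ (γ r) r) := by
    rw [mul_add_one, hturn, signedPeriod]
  have hsum {f : ℝ → ℝ} (hf : Continuous f) :
      ∑ l ∈ Finset.range N, ∫ r in (2 * π * (l : ℝ))..(2 * π * ((l : ℝ) + 1)), f r =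
        ∫ r in (0 : ℝ)..2 * π * N, f r := by
    have := intervalIntegral.sum_integral_adjacent_intervals (f := f)
      (μ := MeasureTheory.volume) (a := fun l : ℕ => 2 * π * (l : ℝ)) (n := N)
      (fun k _ => hf.intervalIntegrable _ _)
    simpa using this
  rw [Function.comp_apply, ← hsum hcχ, ← hsum hcγ, ← Finset.sum_sub_distrib]
  exact Finset.sum_congr rfl fun l _ => by rw [hper l]

end

end CoplanarScattering

open CoplanarScattering
theorem mainTheorem8
    (G h : ℝ → ℝ → ℝ) (T : ℝ → ℝ) (hA : PeriodicOrbitAnsatz G h T)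
    (b : Branch) (D : Set ℝ) (χ : ℝ → ℝ → State) (hχ : IsHomoclinicFamily b G h D χ) :
    ∃ ζ ζp ζm : ℝ → ℝ,
      -- the scattering map is `(J, Ω) ↦ (J, Ω + n ζ(J))`
      (∀ Qm Qp : ExtPhase, Scatters (cylinder G) (channel D χ) Qm Qp ↔
        ∃ J ∈ D, ∃ Ω : Real.Angle, Qm = cylPoint G J Ω ∧
          Qp = cylPoint G J (Ω + ((nOmega * ζ J : ℝ) : Real.Angle))) ∧
      -- `ζp` and `ζm` are the forward and backward asymptotic phases
      (∀ J ∈ D, ∀ Ω : Real.Angle, ∀ P ∈ cylinder G,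
        (channelPoint χ J Ω ∈ stableLeaf P ↔
          P = cylPoint G J (Ω + ((nOmega * ζp J : ℝ) : Real.Angle))) ∧
        (channelPoint χ J Ω ∈ unstableLeaf P ↔
          P = cylPoint G J (Ω + ((nOmega * ζm J : ℝ) : Real.Angle)))) ∧
      ∀ J ∈ D,
        ζ J = ζp J - ζm J ∧ ζp J = -ζm J ∧
        Tendsto (fun N : ℕ => ∑ l ∈ Finset.range N,
          ((∫ s in (2 * π * (l : ℝ))..(2 * π * ((l : ℝ) + 1)), 1 / pd 1 (χ J s))
            - signedPeriod h T J)) atTop (𝓝 (ζp J)) := by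
  choose! ζ hleaf hlim using fun J (hJ : J ∈ D) => exists_asymptotic_phase hA hχ hJ
  refine ⟨fun J => ζ J - -ζ J, ζ, fun J => -ζ J, fun Qm Qp => ⟨?_, ?_⟩, hleaf,
    fun J hJ => ⟨rfl, (neg_neg _).symm, hlim J hJ⟩⟩
  · rintro ⟨hm, hp, _, ⟨J, hJ, Ω, rfl⟩, hQm, hQp⟩
    refine ⟨J, hJ, _, ((hleaf J hJ Ω Qm hm).2.1 hQm), ?_⟩
    rw [(hleaf J hJ Ω Qp hp).1.1 hQp, add_assoc, ← Real.Angle.coe_add]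
    congr 3
    ring
  · rintro ⟨J, hJ, Ω, rfl, rfl⟩
    have hcyl (Ω' : Real.Angle) : cylPoint G J Ω' ∈ cylinder G := ⟨J, hχ.1 hJ, Ω', rfl⟩
    refine ⟨hcyl _, hcyl _, _, ⟨J, hJ, Ω + ((nOmega * ζ J : ℝ) : Real.Angle), rfl⟩,
      (hleaf J hJ _ _ (hcyl _)).2.2 ?_, (hleaf J hJ _ _ (hcyl _)).1.2 ?_⟩
    · rw [add_assoc, ← Real.Angle.coe_add]
      simp
    · rw [add_assoc, ← Real.Angle.coe_add]
      congr 3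
      ring
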